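/- Let $G$ be an amenable group, i.e. a (discrete) group admitting a left invariant mean on its bounded real-valued functions, and let $f,g,h:G\to\mathbb{C}$ be functions. Call $a:G\to\mathbb{C}$ additive if $a(xy)=a(x)+a(y)$ for all $x,y\in G$, and $m:G\to\mathbb{C}$ multiplicative if $m(xy)=m(x)m(y)$ for all $x,y\in G$ (so $m=0$ is allowed unless excluded). Then the function $$(x,y)\mapsto f(xy)-f(x)g(y)-g(x)f(y)-h(x)h(y)$$ is bounded on $G\times G$ if and only if one of the following assertions holds: (1) $f=0$, $g$ is arbitrary and $h$ is bounded; (2) $f,g,h$ are bounded; (3) $f=a\,m+\varphi$, $\ g=(1-\frac{\lambda^2}{2}a)m-\lambda b-\frac{\lambda^2}{2}\varphi$, $\ h=\lambda\,a\,m+b+\lambda\varphi$, where $\lambda\in\mathbb{C}$ is a constant, $a:G\to\mathbb{C}$ is additive, $m:G\to\mathbb{C}$ is bounded and multiplicative, and $b,\varphi:G\to\mathbb{C}$ are bounded; (4) $f=\alpha m-\alpha b$, $\ g=\frac{1-\alpha\lambda^2}{2}m+\frac{1+\alpha\lambda^2}{2}b-\lambda\varphi$, $\ h=\alpha\lambda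 m-\alpha\lambda b+\varphi$, where $\alpha,\lambda\in\mathbb{C}$ are constants, $m:G\to\mathbb{C}$ is multiplicative, and $b,\varphi:G\to\mathbb{C}$ are bounded; (5) $f=f_0$, $\ g=g_0-\frac{\lambda^2}{2}f_0-\lambda b$, $\ h=\lambda f_0+b$, where $\lambda\in\mathbb{C}$ is a constant, $b:G\to\mathbb{C}$ is bounded, and $f_0,g_0:G\to\mathbb{C}$ satisfy the sine functional equation $f_0(xy)=f_0(x)g_0(y)+g_0(x)f_0(y)$ for all $x,y\in G$; (6) $f=-\lambda^2f_0+\lambda^2b$, $\ g=\frac{1+\rho^2}{2}f_0+\rho g_0+\frac{1-\rho^2}{2}b$, $\ h=\lambda\rho f_0+\lambda g_0-\lambda\rho b$, where $\rho\in\mathbb{C}$ and $\lambda\in\mathbb{C}\setminus\{0\}$ are constants, $b:G\to\mathbb{C}$ is bounded, and $f_0,g_0:G\to\mathbb{C}$ satisfy the cosine functional equation $f_0(xy)=f_0(x)f_0(y)-g_0(x)g_0(y)$ for all $x,y\in G$; (7) $f=\lambda^2M+a\,m+b$, $\ g=\beta\lambda(1-\frac12\beta\lambda)M+(1-\beta\lambda)m-\frac12\beta^2a\,m-\frac12\beta^2b$,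 $\ h=\lambda(1-\beta\lambda)M-\lambda m-\beta\,a\,m-\beta b$, where $\beta\in\mathbb{C}$ and $\lambda\in\mathbb{C}\setminus\{0\}$ are constants, $m,M:G\to\mathbb{C}$ are multiplicative with $m$ bounded, $a:G\to\mathbb{C}$ is additive, and $b:G\to\mathbb{C}$ is bounded; (8) $f=\frac12a^2m+\frac12a_1m+b$, $\ g=-\frac14\beta^2a^2m+\beta\,a\,m-\frac14\beta^2a_1m+m-\frac12\beta^2b$, $\ h=-\frac12\beta a^2m+a\,m-\frac12\beta a_1m-\beta b$, where $\beta\in\mathbb{C}$ is a constant, $m:G\to\mathbb{C}$ is nonzero, bounded and multiplicative, $a,a_1:G\to\mathbb{C}$ are additive with $a\neq0$, and $b:G\to\mathbb{C}$ is bounded; (9) $g=-\frac12\beta^2f+(1+\beta a)m+\beta b$ and $h=-\beta f+a\,m+b$, where $\beta\in\mathbb{C}$ is a constant, $a:G\to\mathbb{C}$ is additive, $m:G\to\mathbb{C}$ is nonzero, bounded and multiplicative, and $b:G\to\mathbb{C}$ is a bounded function such that the function $$(x,y)\mapsto f(xy)m((xy)^{-1})-\tfrac12a(xy)^2-\bigl(f(x)m(x^{-1})-\tfrac12a(x)^2\bigr)-\bigl(f(y)m(y^{-1})-\tfrac12a(y)^2\bigr)-a(x)b(y)m(y^{-1})-a(y)b(x)m(x^{-1})$$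 is bounded on $G\times G$; (10) $f(xy)=f(x)g(y)+g(x)f(y)+h(x)h(y)$ for all $x,y\in G$. -/

import Mathlib

/-- The linear space of all bounded `𝕜`-valued functions on `X`. -/
def boundedFunctions (𝕜 : Type*) [NormedField 𝕜] (X : Type*) : Submodule 𝕜 (X → 𝕜) where
  carrier := {f | ∃ C : ℝ, ∀ x, ‖f x‖ ≤ C}
  zero_mem' := ⟨0, fun x => by simp⟩
  add_mem' := by
    rintro f g ⟨C, hC⟩ ⟨D, hD⟩
    exact ⟨C + D, fun x => (norm_add_le (f x) (g x)).trans (add_le_add (hC x) (hD x))⟩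
  smul_mem' := by
    rintro c f ⟨C, hC⟩
    refine ⟨‖c‖ * C, fun x => ?_⟩
    simpa using mul_le_mul_of_nonneg_left (hC x) (norm_nonneg c)

/-- The constant function `1`, as a bounded function. -/
def boundedFunctions.one (X : Type*) : boundedFunctions ℝ X :=
  ⟨fun _ => 1, 1, fun _ => by simp⟩

/-- The left translate `x ↦ φ (s x)` of a bounded function `φ` by `s`. -/
def boundedFunctions.leftTranslate {G : Type*} [Group G] (s : G) (φ : boundedFunctions ℝ G) :
    boundedFunctions ℝ G :=
  ⟨fun x => φ.1 (s * x), φ.2.imp fun _ hC x => hC (s * x)⟩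

/-- A (discrete) group is amenable if there is a left invariant mean on its bounded real
functions, i.e. a linear functional that is positive, normalized and invariant under left
translations. -/
def IsAmenableGroup (G : Type*) [Group G] : Prop :=
  ∃ M : boundedFunctions ℝ G →ₗ[ℝ] ℝ,
    (∀ φ : boundedFunctions ℝ G, (∀ x, 0 ≤ φ.1 x) → 0 ≤ M φ) ∧
    M (boundedFunctions.one G) = 1 ∧
    ∀ (s : G) (φ : boundedFunctions ℝ G), M (boundedFunctions.leftTranslate s φ) = M φ

/-- `a : G → ℂ` is additive. -/
def IsAdditiveFun {G : Type*} [Group G] (a : G → ℂ) : Prop :=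
  ∀ x y, a (x * y) = a x + a y

/-- `m : G → ℂ` is multiplicative (the zero function is allowed). -/
def IsMultiplicativeFun {G : Type*} [Group G] (m : G → ℂ) : Prop :=
  ∀ x y, m (x * y) = m x * m y

/-- The pair `(f₀, g₀)` solves the sine functional equation. -/
def SolvesSine {G : Type*} [Group G] (f₀ g₀ : G → ℂ) : Prop :=
  ∀ x y, f₀ (x * y) = f₀ x * g₀ y + g₀ x * f₀ y

/-- The pair `(f₀, g₀)` solves the cosine functional equation. -/
def SolvesCosine {G : Type*} [Group G] (f₀ g₀ : G → ℂ) : Prop :=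
  ∀ x y, f₀ (x * y) = f₀ x * f₀ y - g₀ x * g₀ y

/-! Everything is read modulo bounded functions. If `f`, `g`, `h` are independent there, expanding
`f((xy)z) = f(x(yz))` and comparing coefficients makes the equation exact (`eq_sum_of_bdd`).

Otherwise there is a relation. A bounded `f` is elementary. If `h = c f + b`, the terms of
`h(x)h(y)` are absorbed into `g`, leaving stability of the sine equation. If `g = γ f + β h + b`,
then `k = h + β f` removes the cross terms and `f(xy)` equals `c f(x)f(y) + f(x)b(y) + b(x)f(y) +
k(x)k(y)` up to a bounded error, with `c = 2γ - β²`. For `c ≠ 0`, completing the square gives the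
cosine equation. For `c = 0`, `b` is multiplicative and `k` satisfies an exact equation with a
parameter `μ`: `μ ≠ 0` leads to (7), `μ = 0` to (8).

Amenability enters only through Hyers' theorem. The forward direction never produces (9), whose
converse is still checked. -/

/-- Bounded complex functions, as a predicate. -/
abbrev Bdd {X : Type*} (f : X → ℂ) : Prop := f ∈ boundedFunctions ℂ X

/-! ### Calculus of bounded functions -/

namespace Bdd

variable {X Y : Type*} {f g : X → ℂ}

theorem add (hf : Bdd f) (hg : Bdd g) : Bdd fun x => f x + g x :=
  (boundedFunctions ℂ X).add_mem hf hg

theorem sub (hf : Bdd f) (hg : Bdd g) : Bdd fun x => f x - g x :=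
  (boundedFunctions ℂ X).sub_mem hf hg

theorem neg (hf : Bdd f) : Bdd fun x => -f x :=
  (boundedFunctions ℂ X).neg_mem hf

theorem const (c : ℂ) : Bdd fun _ : X => c := ⟨‖c‖, fun _ => le_rfl⟩

theorem mul (hf : Bdd f) (hg : Bdd g) : Bdd fun x => f x * g x := by
  obtain ⟨C, hC⟩ := hf
  obtain ⟨D, hD⟩ := hg
  refine ⟨C * D, fun x => ?_⟩
  rw [norm_mul]
  exact mul_le_mul (hC x) (hD x) (norm_nonneg _) ((norm_nonneg _).trans (hC x))

theorem const_mul (c : ℂ) (hf : Bdd f) : Bdd fun x => c * f x := (const c).mul hf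

theorem sum {ι : Type*} {s : Finset ι} {u : ι → X → ℂ} (h : ∀ i ∈ s, Bdd (u i)) :
    Bdd fun x => ∑ i ∈ s, u i x := by
  have := (boundedFunctions ℂ X).sum_mem h
  rwa [Finset.sum_fn] at this

theorem comp (hf : Bdd f) (e : Y → X) : Bdd fun y => f (e y) := hf.imp fun _ hC y => hC (e y)

theorem of_eq (hf : Bdd f) (h : ∀ x, g x = f x) : Bdd g := by
  rwa [show g = f from funext h]

theorem of_const_mul {c : ℂ} (hc : c ≠ 0) (h : Bdd fun x => c * f x) : Bdd f :=
  (h.const_mul c⁻¹).of_eq fun x => by field_simp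

/-- A scalar that keeps an unbounded function bounded vanishes. -/
theorem eq_zero_of_mul {c : ℂ} (h : Bdd fun x => c * f x) (hf : ¬Bdd f) : c = 0 := by
  by_contra hc
  exact hf (of_const_mul hc h)

theorem fst (hf : Bdd f) : Bdd fun p : X × Y => f p.1 := hf.comp Prod.fst

theorem snd (hf : Bdd f) : Bdd fun p : Y × X => f p.2 := hf.comp Prod.snd

theorem map_mul {G : Type*} [Group G] {f : G → ℂ} (hf : Bdd f) :
    Bdd fun p : G × G => f (p.1 * p.2) := hf.comp fun p : G × G => p.1 * p.2

theorem of_map_mul {G : Type*} [Group G] {f : G → ℂ} (hf : Bdd fun p : G × G => f (p.1 * p.2)) :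
    Bdd f :=
  (hf.comp fun x : G => (x, (1 : G))).of_eq fun x => by simp

end Bdd

theorem exists_ne_zero_of_not_bdd {X : Type*} {f : X → ℂ} (hf : ¬Bdd f) : ∃ x, f x ≠ 0 := by
  by_contra! h
  exact hf ((Bdd.const 0).of_eq h)

/-! ### Hyers' theorem and its multiplicative twist -/

/-- Hyers' theorem for real functions on an amenable group. -/
theorem IsAmenableGroup.exists_additive_real {G : Type*} [Group G] (hG : IsAmenableGroup G)
    {F : G → ℝ} {C : ℝ} (hF : ∀ x y, |F (x * y) - F x - F y| ≤ C) :
    ∃ a : G → ℝ, (∀ x y, a (x * y) = a x + a y) ∧ ∀ x, |F x - a x| ≤ C := by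
  obtain ⟨M, hpos, hone, hinv⟩ := hG
  have hmono : ∀ φ ψ : boundedFunctions ℝ G, (∀ x, φ.1 x ≤ ψ.1 x) → M φ ≤ M ψ := by
    intro φ ψ h
    have := hpos (ψ - φ) fun x => sub_nonneg.2 (h x)
    rw [map_sub] at this
    linarith
  -- The increment of `F` under `s` is within `C` of the constant `F s`. Its mean is additive in `s`
  -- by the cocycle identity below and left invariance.
  let φ : G → boundedFunctions ℝ G := fun s =>
    ⟨fun y => F (s * y) - F y, |F s| + C, fun y => by
      have h₁ : F (s * y) - F y = F s + (F (s * y) - F s - F y) := by ring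
      show |F (s * y) - F y| ≤ _
      rw [h₁]
      exact (abs_add_le _ _).trans (by linarith [hF s y])⟩
  have hconst : ∀ c : ℝ, M (c • boundedFunctions.one G) = c := fun c => by
    rw [map_smul, hone, smul_eq_mul, mul_one]
  refine ⟨fun s => M (φ s), fun s t => ?_, fun s => ?_⟩
  · have : φ (s * t) = boundedFunctions.leftTranslate t (φ s) + φ t := by
      ext y
      simp [φ, boundedFunctions.leftTranslate, mul_assoc]
    show M (φ (s * t)) = M (φ s) + M (φ t)
    rw [this, map_add, hinv]
  · have h₁ := hmono (φ s) ((F s + C) • boundedFunctions.one G) fun y => by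
      have := (abs_le.1 (hF s y)).2
      simp only [φ, boundedFunctions.one, Submodule.coe_smul, Pi.smul_apply, smul_eq_mul, mul_one]
      linarith
    have h₂ := hmono ((F s - C) • boundedFunctions.one G) (φ s) fun y => by
      have := (abs_le.1 (hF s y)).1
      simp only [φ, boundedFunctions.one, Submodule.coe_smul, Pi.smul_apply, smul_eq_mul, mul_one]
      linarith
    rw [hconst] at h₁ h₂
    rw [abs_le]
    constructor <;> linarith

/-- Hyers' theorem for complex functions on an amenable group. -/
theorem IsAmenableGroup.exists_additive {G : Type*} [Group G] (hG : IsAmenableGroup G)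
    {F : G → ℂ} (hF : Bdd fun p : G × G => F (p.1 * p.2) - F p.1 - F p.2) :
    ∃ a : G → ℂ, IsAdditiveFun a ∧ Bdd fun x => F x - a x := by
  obtain ⟨C, hC⟩ := hF
  obtain ⟨r, hr, hrC⟩ := hG.exists_additive_real (F := fun x => (F x).re) (C := C) fun x y => by
    simpa using (Complex.abs_re_le_norm _).trans (hC (x, y))
  obtain ⟨i, hi, hiC⟩ := hG.exists_additive_real (F := fun x => (F x).im) (C := C) fun x y => by
    simpa using (Complex.abs_im_le_norm _).trans (hC (x, y))
  refine ⟨fun x => ⟨r x, i x⟩, fun x y => ?_, C + C, fun x => ?_⟩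
  · apply Complex.ext <;> simp [hr, hi]
  · refine (Complex.norm_le_abs_re_add_abs_im _).trans (add_le_add ?_ ?_)
    · simpa using hrC x
    · simpa using hiC x

namespace IsMultiplicativeFun

variable {G : Type*} [Group G] {m : G → ℂ}

theorem mul_inv_eq_one (hm : IsMultiplicativeFun m) (h0 : m ≠ 0) (x : G) : m x * m x⁻¹ = 1 := by
  obtain ⟨y, hy⟩ := Function.ne_iff.1 h0
  have h₁ : m y * (m x * m x⁻¹) = m y := by
    rw [← hm, ← hm]
    simp
  exact mul_left_cancel₀ hy (by rw [h₁, mul_one])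

theorem apply_ne_zero (hm : IsMultiplicativeFun m) (h0 : m ≠ 0) (x : G) : m x ≠ 0 :=
  left_ne_zero_of_mul_eq_one (hm.mul_inv_eq_one h0 x)

theorem apply_inv (hm : IsMultiplicativeFun m) (h0 : m ≠ 0) (x : G) : m x⁻¹ = (m x)⁻¹ :=
  eq_inv_of_mul_eq_one_right (hm.mul_inv_eq_one h0 x)

theorem bdd_inv (hm : IsMultiplicativeFun m) (h0 : m ≠ 0) (hb : Bdd m) : Bdd fun x => (m x)⁻¹ :=
  (hb.comp fun x => x⁻¹).of_eq fun x => (hm.apply_inv h0 x).symm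

end IsMultiplicativeFun

/-- The stability of `φ(xy) = φ(x)m(y) + m(x)φ(y)` for a bounded multiplicative `m`. -/
theorem IsAmenableGroup.exists_additive_mul {G : Type*} [Group G] (hG : IsAmenableGroup G)
    {m φ : G → ℂ} (hm : IsMultiplicativeFun m) (hmb : Bdd m)
    (hφ : Bdd fun p : G × G => φ (p.1 * p.2) - φ p.1 * m p.2 - m p.1 * φ p.2) :
    ∃ a b : G → ℂ, IsAdditiveFun a ∧ Bdd b ∧ ∀ x, φ x = a x * m x + b x := by
  by_cases h0 : m = 0
  · subst h0
    refine ⟨0, φ, fun x y => by simp, (Bdd.of_map_mul (hφ.of_eq fun p => ?_)), fun x => by simp⟩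
    simp
  -- Dividing by `m`, whose inverse is bounded, reduces to the additive equation.
  · have hi := hm.bdd_inv h0 hmb
    obtain ⟨a, ha, hb⟩ := hG.exists_additive (F := fun x => φ x * (m x)⁻¹)
      (((hφ.mul hi.fst).mul hi.snd).of_eq fun p => by
        have h₁ := hm.apply_ne_zero h0 p.1
        have h₂ := hm.apply_ne_zero h0 p.2
        rw [hm]
        field_simp)
    refine ⟨a, _, ha, hb.mul hmb, fun x => ?_⟩
    have := hm.apply_ne_zero h0 x
    field_simp
    ring

/-! ### Independence modulo bounded functions and superstability -/

/-- Linear independence of a finite family of functions modulo the bounded functions. -/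
def IndepModBdd {X ι : Type*} [Fintype ι] (u : ι → X → ℂ) : Prop :=
  ∀ c : ι → ℂ, Bdd (fun x => ∑ i, c i * u i x) → c = 0

/-- If `f(xy) - ∑ uᵢ(x)vᵢ(y)` is bounded, where `u` and `v` are linearly independent modulo the
bounded functions and `f` is in the span of `u`, then this difference vanishes. -/
theorem eq_sum_of_bdd {G ι : Type*} [Group G] [Fintype ι] {u v : ι → G → ℂ} {f : G → ℂ}
    {α : ι → ℂ} (hu : IndepModBdd u) (hv : IndepModBdd v) (hf : ∀ x, f x = ∑ i, α i * u i x)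
    (hD : Bdd fun p : G × G => f (p.1 * p.2) - ∑ i, u i p.1 * v i p.2) (x y : G) :
    f (x * y) = ∑ i, u i x * v i y := by
  classical
  -- Coefficients `w` for which the right translates of `∑ wᵢuᵢ` stay in the span of `u`, up to an
  -- error bounded in both variables.
  let S : Submodule ℂ (ι → ℂ) :=
    { carrier := {w | ∃ K : ι → G → ℂ,
        Bdd fun p : G × G => ∑ i, w i * u i (p.1 * p.2) - ∑ j, u j p.1 * K j p.2}
      zero_mem' := ⟨0, (Bdd.const 0).of_eq fun p => by simp⟩
      add_mem' := by
        rintro w w' ⟨K, hK⟩ ⟨K', hK'⟩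
        refine ⟨K + K', (hK.add hK').of_eq fun p => ?_⟩
        simp only [Pi.add_apply, add_mul, mul_add, Finset.sum_add_distrib]
        ring
      smul_mem' := by
        rintro c w ⟨K, hK⟩
        refine ⟨c • K, (hK.const_mul c).of_eq fun p => ?_⟩
        simp only [Pi.smul_apply, smul_eq_mul, mul_sub, Finset.mul_sum]
        congr 1 <;> exact Finset.sum_congr rfl fun _ _ => by ring }
  -- By associativity every vector `(vᵢ(z))ᵢ` lies in `S`. A functional killing `S` is thus a linear
  -- relation among the `vᵢ`, hence zero.
  have hS : S = ⊤ := by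
    by_contra hne
    obtain ⟨l, hl, hle⟩ := S.exists_le_ker_of_lt_top (lt_top_iff_ne_top.2 hne)
    have hlw : ∀ w, l w = ∑ i, l (Pi.single i 1) * w i := fun w => by
      conv_lhs => rw [pi_eq_sum_univ' w]
      simp [mul_comm]
    apply hl
    have hc := hv (fun i => l (Pi.single i 1)) ((Bdd.const 0).of_eq fun z => by
      rw [← hlw fun i => v i z]
      refine hle (x := fun i => v i z) ⟨fun j y => v j (y * z), ?_⟩
      refine ((hD.comp fun p : G × G => (p.1, p.2 * z)).sub
        (hD.comp fun p : G × G => (p.1 * p.2, z))).of_eq fun p => ?_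
      simp only [mul_assoc, mul_comm (v _ z)]
      ring)
    ext i
    exact congrFun hc i
  have hK : ∀ i, ∃ K : ι → G → ℂ, Bdd fun p : G × G =>
      u i (p.1 * p.2) - ∑ j, u j p.1 * K j p.2 := fun i => by
    obtain ⟨K, hK⟩ : (Pi.single i 1 : ι → ℂ) ∈ S := hS ▸ Submodule.mem_top
    exact ⟨K, hK.of_eq fun p => by simp [Pi.single_apply]⟩
  choose K hK using hK
  -- Associativity again. Boundedness in `x` first makes the formula for `v(yz)` exact; boundedness
  -- in `z` then does the same for `u(xy)`.
  have key : ∀ x y z, ∑ i, (u i (x * y) - ∑ j, u j x * K i j y) * v i z =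
      (∑ j, (v j (y * z) - ∑ i, K i j y * v i z) * u j x) +
        ((f (x * (y * z)) - ∑ i, u i x * v i (y * z)) -
          (f (x * y * z) - ∑ i, u i (x * y) * v i z)) := by
    intro x y z
    have h₁ : ∑ i, (∑ j, u j x * K i j y) * v i z = ∑ j, (∑ i, K i j y * v i z) * u j x := by
      simp only [Finset.sum_mul]
      rw [Finset.sum_comm]
      exact Finset.sum_congr rfl fun _ _ => Finset.sum_congr rfl fun _ _ => by ring
    simp only [sub_mul, Finset.sum_sub_distrib, h₁, mul_assoc, mul_comm (v _ (y * z))]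
    ring
  have hv' : ∀ y z, (fun j => v j (y * z) - ∑ i, K i j y * v i z) = 0 := fun y z => by
    refine hu _ ?_
    have h₁ : Bdd fun x => ∑ i, (u i (x * y) - ∑ j, u j x * K i j y) * v i z :=
      Bdd.sum fun i _ => ((hK i).comp fun x => (x, y)).mul (Bdd.const _)
    refine ((h₁.sub (hD.comp fun x => (x, y * z))).add (hD.comp fun x => (x * y, z))).of_eq
      fun x => ?_
    rw [key]
    ring
  have hd : ∀ x y i, u i (x * y) = ∑ j, u j x * K i j y := fun x y i => by
    have := hv (fun i => u i (x * y) - ∑ j, u j x * K i j y)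
      (((hD.comp fun z => (x, y * z)).sub (hD.comp fun z => (x * y, z))).of_eq fun z => by
        rw [key, Finset.sum_eq_zero fun j _ => by rw [congrFun (hv' y z) j]; simp]
        ring)
    exact sub_eq_zero.1 (congrFun this i)
  have hfK : ∀ x y, f (x * y) = ∑ j, (∑ i, α i * K i j y) * u j x := fun x y => by
    rw [hf]
    simp only [hd, Finset.mul_sum, Finset.sum_mul]
    rw [Finset.sum_comm]
    exact Finset.sum_congr rfl fun _ _ => Finset.sum_congr rfl fun _ _ => by ring
  have hvK := hu (fun j => ∑ i, α i * K i j y - v j y)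
    ((hD.comp fun x => (x, y)).of_eq fun x => by
      simp only [hfK, sub_mul, Finset.sum_sub_distrib, mul_comm (v _ y)])
  rw [hfK]
  refine Finset.sum_congr rfl fun j _ => ?_
  rw [sub_eq_zero.1 (congrFun hvK j), mul_comm]

theorem indepModBdd_two {X : Type*} {f h : X → ℂ} (hf : ¬Bdd f)
    (hh : ¬∃ c : ℂ, Bdd fun x => h x - c * f x) : IndepModBdd ![f, h] := by
  intro c hc
  simp only [Fin.sum_univ_two, Matrix.cons_val_zero, Matrix.cons_val_one] at hc
  have h1 : c 1 = 0 := by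
    by_contra h1
    exact hh ⟨-(c 0 / c 1), (hc.const_mul (c 1)⁻¹).of_eq fun x => by field_simp; ring⟩
  have h0 : c 0 = 0 := Bdd.eq_zero_of_mul (hc.of_eq fun x => by rw [h1]; ring) hf
  ext i
  fin_cases i <;> simp [h0, h1]

/-- Transfers independence from the left factors to the right ones, which are the same functions
permuted and rescaled. -/
theorem IndepModBdd.of_comp {X ι : Type*} [Fintype ι] {u v : ι → X → ℂ} (hu : IndepModBdd u)
    (d : ι → ℂ) (hd : ∀ i, d i ≠ 0) (e : ι ≃ ι) (hv : ∀ i x, v i x = d i * u (e i) x) :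
    IndepModBdd v := by
  intro c hc
  have := hu (fun j => c (e.symm j) * d (e.symm j)) (hc.of_eq fun x => by
    rw [← e.sum_comp]
    exact Finset.sum_congr rfl fun i _ => by simp [hv, mul_assoc])
  ext i
  have h := congrFun this (e i)
  simpa [hd] using h

/-- Superstability of the exponential equation. -/
theorem isMultiplicativeFun_of_bdd {G : Type*} [Group G] {M : G → ℂ} (hM : ¬Bdd M)
    (hD : Bdd fun p : G × G => M (p.1 * p.2) - M p.1 * M p.2) : IsMultiplicativeFun M := by
  have hu : IndepModBdd fun _ : Unit => M := fun c hc => by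
    ext
    exact Bdd.eq_zero_of_mul (hc.of_eq fun x => by simp) hM
  intro x y
  simpa using eq_sum_of_bdd (α := 1) hu hu (by simp) (hD.of_eq fun p => by simp) x y

theorem solvesSine_of_bdd {G : Type*} [Group G] {f g : G → ℂ} (hu : IndepModBdd ![f, g])
    (hD : Bdd fun p : G × G => f (p.1 * p.2) - f p.1 * g p.2 - g p.1 * f p.2) :
    SolvesSine f g := by
  have hv : IndepModBdd ![g, f] := hu.of_comp 1 (by simp) (Equiv.swap 0 1) (by
    intro i x
    fin_cases i <;> simp)
  intro x y
  have := eq_sum_of_bdd (f := f) (α := ![1, 0]) hu hv (by simp)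
    (hD.of_eq fun p => by simp; ring) x y
  simpa using this

theorem solvesCosine_of_bdd {G : Type*} [Group G] {f g : G → ℂ} (hu : IndepModBdd ![f, g])
    (hD : Bdd fun p : G × G => f (p.1 * p.2) - f p.1 * f p.2 + g p.1 * g p.2) :
    SolvesCosine f g := by
  have hv : IndepModBdd ![f, fun x => -g x] := hu.of_comp ![1, -1]
    (by intro i; fin_cases i <;> simp) (Equiv.refl _) (by
      intro i x
      fin_cases i <;> simp)
  intro x y
  have := eq_sum_of_bdd (f := f) (α := ![1, 0]) hu hv (by simp)
    (hD.of_eq fun p => by simp; ring) x y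
  rw [this]
  simp
  ring

theorem eq_of_bdd_three {G : Type*} [Group G] {f g h : G → ℂ} (hu : IndepModBdd ![f, g, h])
    (hD : Bdd fun p : G × G =>
      f (p.1 * p.2) - f p.1 * g p.2 - g p.1 * f p.2 - h p.1 * h p.2) (x y : G) :
    f (x * y) = f x * g y + g x * f y + h x * h y := by
  have hv : IndepModBdd ![g, f, h] := hu.of_comp 1 (by simp) (Equiv.swap 0 1) (by
    intro i x
    fin_cases i <;> simp [Equiv.swap_apply_def])
  have := eq_sum_of_bdd (f := f) (α := ![1, 0, 0]) hu hv (by simp [Fin.sum_univ_three])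
    (hD.of_eq fun p => by simp [Fin.sum_univ_three]; ring) x y
  simpa [Fin.sum_univ_three] using this

/-! ### Dependent cases -/

/-- If `f` is bounded and nonzero, then `g` and `h` are bounded. -/
theorem bdd_of_bdd_of_ne_zero {G : Type*} [Group G] {f g h : G → ℂ} (hf : Bdd f) (h0 : f ≠ 0)
    (hD : Bdd fun p : G × G =>
      f (p.1 * p.2) - f p.1 * g p.2 - g p.1 * f p.2 - h p.1 * h p.2) : Bdd g ∧ Bdd h := by
  obtain ⟨z, hz⟩ := Function.ne_iff.1 h0
  have hz : f z ≠ 0 := hz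
  have hE : Bdd fun p : G × G => f p.1 * g p.2 + g p.1 * f p.2 + h p.1 * h p.2 :=
    (hf.map_mul.sub hD).of_eq fun p => by ring
  have hg : Bdd fun x => g x - -(h z / f z) * h x := by
    refine (((hE.comp fun x => (x, z)).sub (hf.mul (Bdd.const (g z)))).const_mul (f z)⁻¹).of_eq
      fun x => ?_
    field_simp
    ring
  have hh : Bdd h := by
    by_contra hh
    -- This is the coefficient of the unbounded `h(y)` once `g` is replaced by a multiple of `h`.
    have hx : ∀ x, h x + -(h z / f z) * f x = 0 := fun x => by
      refine Bdd.eq_zero_of_mul (f := h) ?_ hh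
      refine (((hE.comp fun y => (x, y)).sub (hg.const_mul (f x))).sub
        (hf.const_mul (g x))).of_eq fun y => ?_
      ring
    exact hh ((hf.const_mul (h z / f z)).of_eq fun x => by linear_combination hx x)
  exact ⟨(hg.add (hh.const_mul (-(h z / f z)))).of_eq fun x => by ring, hh⟩

/-- Stability of the sine equation on amenable groups. -/
theorem IsAmenableGroup.sine_stability {G : Type*} [Group G] (hG : IsAmenableGroup G)
    {f g : G → ℂ} (hf : ¬Bdd f)
    (hD : Bdd fun p : G × G => f (p.1 * p.2) - f p.1 * g p.2 - g p.1 * f p.2) :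
    (IsMultiplicativeFun g ∧ Bdd g ∧
      ∃ a φ : G → ℂ, IsAdditiveFun a ∧ Bdd φ ∧ ∀ x, f x = a x * g x + φ x) ∨
    (∃ (α : ℂ) (m b : G → ℂ), IsMultiplicativeFun m ∧ Bdd b ∧
      (∀ x, f x = α * m x - α * b x) ∧ ∀ x, g x = 1 / 2 * m x + 1 / 2 * b x) ∨
    SolvesSine f g := by
  by_cases hind : ∃ c : ℂ, Bdd fun x => g x - c * f x
  swap
  · exact Or.inr (Or.inr (solvesSine_of_bdd (indepModBdd_two hf hind) hD))
  obtain ⟨c, hb⟩ := hind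
  by_cases hc : c = 0
  · left
    have hg : Bdd g := hb.of_eq fun x => by rw [hc]; ring
    -- In the two expansions of `f(xyz)`, the unbounded `f(x)` has coefficient `g(yz) - g(y)g(z)`.
    have hm : IsMultiplicativeFun g := fun y z => by
      refine sub_eq_zero.1 (Bdd.eq_zero_of_mul (f := f) ?_ hf)
      refine (((hD.comp fun x => (x * y, z)).sub (hD.comp fun x => (x, y * z))).add
        (((hD.comp fun x => (x, y)).mul (Bdd.const (g z))).add
          (((hg.comp fun x => x * y).mul (Bdd.const (f z))).sub
            (hg.mul (Bdd.const (f (y * z) - f y * g z)))))).of_eq fun x => ?_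
      simp only [mul_assoc]
      ring
    obtain ⟨a, φ, ha, hφ, hfa⟩ := hG.exists_additive_mul hm hg hD
    exact ⟨hm, hg, a, φ, ha, hφ, hfa⟩
  · right; left
    -- Completing the square in `2c f(x)f(y) + f(x)b(y) + b(x)f(y)`, where `b = g - c f`.
    have hM : IsMultiplicativeFun fun x => 2 * c * f x + (g x - c * f x) := by
      refine isMultiplicativeFun_of_bdd (fun h => hf ?_) ?_
      · exact Bdd.of_const_mul (c := 2 * c) (by simpa using hc)
          ((h.sub hb).of_eq fun x => by ring)
      · refine (((hD.const_mul (2 * c)).add hb.map_mul).sub (hb.fst.mul hb.snd)).of_eq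
          fun p => ?_
        ring
    refine ⟨(2 * c)⁻¹, _, _, hM, hb, fun x => ?_, fun x => ?_⟩
    · field_simp
      ring
    · ring

/-- The equation `f(xy) = f(x)b(y) + b(x)f(y) + k(x)k(y)` up to bounded functions, with `b` bounded
and `f`, `k` independent modulo bounded functions. -/
theorem exists_of_bdd_of_indep {G : Type*} [Group G] {f k b : G → ℂ}
    (hu : IndepModBdd ![f, k]) (hk : ¬Bdd k) (hb : Bdd b)
    (hD : Bdd fun p : G × G =>
      f (p.1 * p.2) - f p.1 * b p.2 - b p.1 * f p.2 - k p.1 * k p.2) :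
    IsMultiplicativeFun b ∧
      ∃ μ : ℂ, ∀ x y, k (x * y) = k x * b y + b x * k y + μ * (k x * k y) := by
  obtain ⟨z₀, hz₀⟩ := exists_ne_zero_of_not_bdd hk
  have hu' : ∀ c d : ℂ, Bdd (fun x => c * f x + d * k x) → c = 0 ∧ d = 0 := fun c d h => by
    have := hu ![c, d] (h.of_eq fun x => by simp)
    exact ⟨congrFun this 0, congrFun this 1⟩
  -- The difference of the two expansions of `f(xyz)`.
  let E : G → G → G → ℂ := fun x y z =>
    f x * (b y * b z - b (y * z)) + k x * (k y * b z - k (y * z)) +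
      (b (x * y) - b x * b y) * f z + (k (x * y) - b x * k y) * k z
  have hE : Bdd fun p : G × G × G => E p.1 p.2.1 p.2.2 := by
    refine ((((hD.comp fun p : G × G × G => (p.1, p.2.1 * p.2.2)).sub
      (hD.comp fun p : G × G × G => (p.1 * p.2.1, p.2.2))).sub
      ((hD.comp fun p : G × G × G => (p.1, p.2.1)).mul (hb.comp fun p : G × G × G => p.2.2))).add
      ((hb.comp fun p : G × G × G => p.1).mul
        (hD.comp fun p : G × G × G => (p.2.1, p.2.2)))).of_eq fun p => ?_
    simp only [E, mul_assoc]
    ring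
  -- Freezing `z = z₀` in `E` and dividing by `k z₀` solves for `k(xy)` up to a bounded error.
  set A : G → ℂ := fun y => (b (y * z₀) - b y * b z₀) / k z₀ with hA
  set B : G → ℂ := fun y => (k (y * z₀) - k y * b z₀) / k z₀ with hB
  have hd : Bdd fun p : G × G =>
      k (p.1 * p.2) - f p.1 * A p.2 - k p.1 * B p.2 - b p.1 * k p.2 := by
    refine (((hE.comp fun p : G × G => (p.1, p.2, z₀)).sub
      ((hb.map_mul.sub (hb.fst.mul hb.snd)).mul (Bdd.const (f z₀)))).const_mul (k z₀)⁻¹).of_eq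
      fun p => ?_
    simp only [E, hA, hB]
    field_simp
    ring
  have hyz : ∀ y z, b y * b z - b (y * z) + A y * k z = 0 ∧
      k y * b z - k (y * z) + B y * k z = 0 := fun y z => by
    refine hu' _ _ ?_
    refine (((hE.comp fun x => (x, y, z)).sub (((hb.comp fun x => x * y).sub
      (hb.mul (Bdd.const (b y)))).mul (Bdd.const (f z)))).sub
      ((hd.comp fun x => (x, y)).mul (Bdd.const (k z)))).of_eq fun x => ?_
    simp only [E]
    ring
  have hA0 : ∀ y, A y = 0 := fun y => by
    refine Bdd.eq_zero_of_mul (f := k) ?_ hk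
    refine ((hb.comp fun z => y * z).sub (hb.const_mul (b y))).of_eq fun z => ?_
    linear_combination (hyz y z).1
  have hbm : IsMultiplicativeFun b := fun y z => by
    have := (hyz y z).1
    rw [hA0] at this
    linear_combination -this
  have hkB : ∀ x y, k (x * y) = k x * b y + B x * k y := fun x y => by
    linear_combination -(hyz x y).2
  have hkB' : ∀ x y, k (x * y) = b x * k y + B y * k x := fun x y => by
    refine sub_eq_zero.1 (Bdd.eq_zero_of_mul (f := k) ?_ hk)
    refine (hE.comp fun z => (x, y, z)).of_eq fun z => ?_
    simp only [E, hbm x y, hbm y z]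
    linear_combination -k x * (hyz y z).2
  -- Equating the two formulas for `k(x z₀)` shows that `B - b` is a multiple of `k`.
  refine ⟨hbm, (B z₀ - b z₀) / k z₀, fun x y => ?_⟩
  have h₁ := hkB x z₀
  rw [hkB' x z₀] at h₁
  have h₂ : (B z₀ - b z₀) / k z₀ * k x = B x - b x := by
    field_simp
    linear_combination h₁
  rw [hkB]
  linear_combination -k y * h₂

/-! ### Assembling the classification -/

theorem theorem4p1 {G : Type*} [Group G] (hG : IsAmenableGroup G) (f g h : G → ℂ) :
    (fun p : G × G => f (p.1 * p.2) - f p.1 * g p.2 - g p.1 * f p.2 - h p.1 * h p.2) ∈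
        boundedFunctions ℂ (G × G) ↔
      -- (1)
      (f = 0 ∧ h ∈ boundedFunctions ℂ G) ∨
      -- (2)
      (f ∈ boundedFunctions ℂ G ∧ g ∈ boundedFunctions ℂ G ∧ h ∈ boundedFunctions ℂ G) ∨
      -- (3)
      (∃ (lam : ℂ) (a m b φ : G → ℂ),
        IsAdditiveFun a ∧ IsMultiplicativeFun m ∧ m ∈ boundedFunctions ℂ G ∧
        b ∈ boundedFunctions ℂ G ∧ φ ∈ boundedFunctions ℂ G ∧
        (∀ x, f x = a x * m x + φ x) ∧
        (∀ x, g x = (1 - lam ^ 2 / 2 * a x) * m x - lam * b x - lam ^ 2 / 2 * φ x) ∧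
        (∀ x, h x = lam * a x * m x + b x + lam * φ x)) ∨
      -- (4)
      (∃ (α lam : ℂ) (m b φ : G → ℂ),
        IsMultiplicativeFun m ∧ b ∈ boundedFunctions ℂ G ∧ φ ∈ boundedFunctions ℂ G ∧
        (∀ x, f x = α * m x - α * b x) ∧
        (∀ x, g x = (1 - α * lam ^ 2) / 2 * m x + (1 + α * lam ^ 2) / 2 * b x - lam * φ x) ∧
        (∀ x, h x = α * lam * m x - α * lam * b x + φ x)) ∨
      -- (5)
      (∃ (lam : ℂ) (b f₀ g₀ : G → ℂ),
        b ∈ boundedFunctions ℂ G ∧ SolvesSine f₀ g₀ ∧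
        (∀ x, f x = f₀ x) ∧
        (∀ x, g x = g₀ x - lam ^ 2 / 2 * f₀ x - lam * b x) ∧
        (∀ x, h x = lam * f₀ x + b x)) ∨
      -- (6)
      (∃ (ρ lam : ℂ) (b f₀ g₀ : G → ℂ),
        lam ≠ 0 ∧ b ∈ boundedFunctions ℂ G ∧ SolvesCosine f₀ g₀ ∧
        (∀ x, f x = -lam ^ 2 * f₀ x + lam ^ 2 * b x) ∧
        (∀ x, g x = (1 + ρ ^ 2) / 2 * f₀ x + ρ * g₀ x + (1 - ρ ^ 2) / 2 * b x) ∧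
        (∀ x, h x = lam * ρ * f₀ x + lam * g₀ x - lam * ρ * b x)) ∨
      -- (7)
      (∃ (β lam : ℂ) (m M a b : G → ℂ),
        lam ≠ 0 ∧ IsMultiplicativeFun m ∧ IsMultiplicativeFun M ∧ m ∈ boundedFunctions ℂ G ∧
        IsAdditiveFun a ∧ b ∈ boundedFunctions ℂ G ∧
        (∀ x, f x = lam ^ 2 * M x + a x * m x + b x) ∧
        (∀ x, g x = β * lam * (1 - 1 / 2 * β * lam) * M x + (1 - β * lam) * m x
          - 1 / 2 * β ^ 2 * a x * m x - 1 / 2 * β ^ 2 * b x) ∧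
        (∀ x, h x = lam * (1 - β * lam) * M x - lam * m x - β * a x * m x - β * b x)) ∨
      -- (8)
      (∃ (β : ℂ) (m a a₁ b : G → ℂ),
        IsMultiplicativeFun m ∧ m ≠ 0 ∧ m ∈ boundedFunctions ℂ G ∧
        IsAdditiveFun a ∧ IsAdditiveFun a₁ ∧ a ≠ 0 ∧ b ∈ boundedFunctions ℂ G ∧
        (∀ x, f x = 1 / 2 * a x ^ 2 * m x + 1 / 2 * a₁ x * m x + b x) ∧
        (∀ x, g x = -(1 / 4) * β ^ 2 * a x ^ 2 * m x + β * a x * m x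
          - 1 / 4 * β ^ 2 * a₁ x * m x + m x - 1 / 2 * β ^ 2 * b x) ∧
        (∀ x, h x = -(1 / 2) * β * a x ^ 2 * m x + a x * m x - 1 / 2 * β * a₁ x * m x
          - β * b x)) ∨
      -- (9)
      (∃ (β : ℂ) (a m b : G → ℂ),
        IsAdditiveFun a ∧ IsMultiplicativeFun m ∧ m ≠ 0 ∧ m ∈ boundedFunctions ℂ G ∧
        b ∈ boundedFunctions ℂ G ∧
        (∀ x, g x = -(1 / 2) * β ^ 2 * f x + (1 + β * a x) * m x + β * b x) ∧
        (∀ x, h x = -β * f x + a x * m x + b x) ∧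
        (fun p : G × G =>
          f (p.1 * p.2) * m (p.1 * p.2)⁻¹ - 1 / 2 * a (p.1 * p.2) ^ 2
            - (f p.1 * m p.1⁻¹ - 1 / 2 * a p.1 ^ 2)
            - (f p.2 * m p.2⁻¹ - 1 / 2 * a p.2 ^ 2)
            - a p.1 * b p.2 * m p.2⁻¹ - a p.2 * b p.1 * m p.1⁻¹) ∈
          boundedFunctions ℂ (G × G)) ∨
      -- (10)
      (∀ x y, f (x * y) = f x * g y + g x * f y + h x * h y) := by
  constructor
  · intro hD
    have hD : Bdd fun p : G × G =>
      f (p.1 * p.2) - f p.1 * g p.2 - g p.1 * f p.2 - h p.1 * h p.2 := hD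
    by_cases hf : Bdd f
    · by_cases h0 : f = 0
      · refine Or.inl ⟨h0, ?_⟩
        by_contra hh
        obtain ⟨z, hz⟩ := exists_ne_zero_of_not_bdd hh
        exact hz (Bdd.eq_zero_of_mul ((hD.comp fun x => (z, x)).neg.of_eq fun x => by
          simp [h0]) hh)
      · exact Or.inr (Or.inl ⟨hf, bdd_of_bdd_of_ne_zero hf h0 hD⟩)
    by_cases hfh : ∃ c : ℂ, Bdd fun x => h x - c * f x
    · obtain ⟨c, hb⟩ := hfh
      set b : G → ℂ := fun x => h x - c * f x with hbdef
      have hhx : ∀ x, h x = c * f x + b x := fun x => by simp [hbdef]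
      rcases hG.sine_stability (g := fun x => g x + c ^ 2 / 2 * f x + c * b x) hf
        ((hD.add (hb.fst.mul hb.snd)).of_eq fun p => by simp only [hhx]; ring) with
        ⟨hm, hmb, a, φ, ha, hφ, hfa⟩ | ⟨α, m, b', hm, hb', hfm, hgm⟩ | hs
      · refine Or.inr (Or.inr (Or.inl ⟨c, a, _, b, φ, ha, hm, hmb, hb, hφ, hfa,
          fun x => ?_, fun x => ?_⟩))
        · linear_combination -(c ^ 2 / 2) * hfa x
        · linear_combination hhx x + c * hfa x
      · refine Or.inr (Or.inr (Or.inr (Or.inl ⟨α, c, m, b', b, hm, hb', hb, hfm,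
          fun x => ?_, fun x => ?_⟩)))
        · linear_combination hgm x - c ^ 2 / 2 * hfm x
        · linear_combination hhx x + c * hfm x
      · exact Or.inr (Or.inr (Or.inr (Or.inr (Or.inl ⟨c, b, f, _, hb, hs, fun x => rfl,
          fun x => by ring, hhx⟩))))
    have hfh2 := indepModBdd_two hf hfh
    by_cases hind : ∃ γ δ : ℂ, Bdd fun x => g x - γ * f x - δ * h x
    swap
    · refine Or.inr (Or.inr (Or.inr (Or.inr (Or.inr (Or.inr (Or.inr (Or.inr (Or.inr
        (eq_of_bdd_three (fun c hc => ?_) hD)))))))))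
      simp only [Fin.sum_univ_three, Matrix.cons_val_zero, Matrix.cons_val_one,
        Matrix.cons_val] at hc
      have h1 : c 1 = 0 := by
        by_contra h1
        exact hind ⟨-(c 0 / c 1), -(c 2 / c 1), (hc.const_mul (c 1)⁻¹).of_eq fun x => by
          field_simp; ring⟩
      have h02 := hfh2 ![c 0, c 2] (hc.of_eq fun x => by simp [h1])
      have h0 : c 0 = 0 := congrFun h02 0
      have h2 : c 2 = 0 := congrFun h02 1
      ext i
      fin_cases i <;> simp [h0, h1, h2]
    obtain ⟨γ, β, hb⟩ := hind
    set b : G → ℂ := fun x => g x - γ * f x - β * h x with hbdef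
    obtain ⟨k, hkdef⟩ : ∃ k : G → ℂ, ∀ x, h x = -β * f x + k x :=
      ⟨fun x => h x + β * f x, fun x => by ring⟩
    obtain ⟨c, hc⟩ : ∃ c : ℂ, c = 2 * γ - β ^ 2 := ⟨_, rfl⟩
    have hgx : ∀ x, g x = c / 2 * f x - β ^ 2 / 2 * f x + β * k x + b x := fun x => by
      simp only [hbdef, hkdef, hc]
      ring
    have hfk : ¬∃ c : ℂ, Bdd fun x => k x - c * f x := fun ⟨d, hd⟩ =>
      hfh ⟨d - β, hd.of_eq fun x => by rw [hkdef]; ring⟩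
    have hk : ¬Bdd k := fun hk => hfk ⟨0, hk.of_eq fun x => by ring⟩
    have hD' : Bdd fun p : G × G => f (p.1 * p.2) - c * f p.1 * f p.2 - f p.1 * b p.2 -
        b p.1 * f p.2 - k p.1 * k p.2 := hD.of_eq fun p => by
      simp only [hgx, hkdef]
      ring
    by_cases hc0 : c = 0
    · obtain ⟨hm, μ, hμ⟩ := exists_of_bdd_of_indep (indepModBdd_two hf hfk) hk hb
        (hD'.of_eq fun p => by rw [hc0]; ring)
      by_cases hμ0 : μ = 0
      · have hb0 : b ≠ 0 := fun h0 => hk ((Bdd.const 0).of_eq fun x => by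
          simpa [h0, hμ0] using hμ x 1)
        have hi := hm.bdd_inv hb0 hb
        obtain ⟨a, ha⟩ : ∃ a : G → ℂ, ∀ x, k x = a x * b x :=
          ⟨fun x => k x * (b x)⁻¹, fun x => by
            have := hm.apply_ne_zero hb0 x
            field_simp⟩
        have haa : IsAdditiveFun a := fun x y => by
          have := hμ x y
          rw [hμ0, ha, ha, ha, hm x y] at this
          exact mul_right_cancel₀
            (mul_ne_zero (hm.apply_ne_zero hb0 x) (hm.apply_ne_zero hb0 y))
            (by linear_combination this)
        -- The cross term of `½a(xy)²` accounts exactly for `k(x)k(y)`, where `k = a b`.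
        obtain ⟨a₁, b', ha₁, hb', hφ⟩ := hG.exists_additive_mul
          (φ := fun x => f x - 1 / 2 * a x ^ 2 * b x) hm hb (hD'.of_eq fun p => by
            simp only [ha, haa p.1 p.2, hm p.1 p.2, hc0]
            ring)
        have hfx : ∀ x, f x = 1 / 2 * a x ^ 2 * b x + 1 / 2 * (2 * a₁ x) * b x + b' x :=
          fun x => by linear_combination hφ x
        refine Or.inr (Or.inr (Or.inr (Or.inr (Or.inr (Or.inr (Or.inr (Or.inl ⟨β, b, a,
          fun x => 2 * a₁ x, b', hm, hb0, hb, haa, fun x y => by simp only [ha₁ x y]; ring,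
          fun h0 => hk ((Bdd.const 0).of_eq fun x => by simp [ha, h0]), hb', hfx,
          fun x => ?_, fun x => ?_⟩)))))))
        · rw [hgx, ha, hfx, hc0]
          ring
        · rw [hkdef, ha, hfx]
          ring
      · have hM : IsMultiplicativeFun fun x => b x + μ * k x := fun x y => by
          simp only [hm x y, hμ x y]
          ring
        -- With `M = b + μk`, `k(x)k(y) = μ⁻²(M - b)(x)(M - b)(y)`, so subtracting `μ⁻²M` from `f`
        -- leaves only a bounded term.
        obtain ⟨a, b', ha, hb', hφ⟩ := hG.exists_additive_mul
          (φ := fun x => f x - μ⁻¹ ^ 2 * (b x + μ * k x)) hm hb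
          ((hD'.add ((hb.fst.mul hb.snd).const_mul (μ⁻¹ ^ 2))).of_eq fun p => by
            simp only [hm p.1 p.2, hμ p.1 p.2, hc0]
            field_simp
            ring)
        have hfx : ∀ x, f x = μ⁻¹ ^ 2 * (b x + μ * k x) + a x * b x + b' x :=
          fun x => by linear_combination hφ x
        refine Or.inr (Or.inr (Or.inr (Or.inr (Or.inr (Or.inr (Or.inl ⟨β, μ⁻¹, b, _, a, b',
          inv_ne_zero hμ0, hm, hM, hb, ha, hb', hfx, fun x => ?_, fun x => ?_⟩))))))
        · rw [hgx, hfx, hc0]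
          field_simp
          ring
        · rw [hkdef, hfx]
          field_simp
          ring
    · obtain ⟨s, hs⟩ := IsAlgClosed.exists_pow_nat_eq (-c) (n := 2) (by norm_num)
      have hs0 : s ≠ 0 := fun h0 => hc0 (by simpa [h0] using hs.symm)
      obtain rfl : c = -s ^ 2 := by rw [hs]; ring
      -- Here `F = c f + b` completes the square, and `s² = -c` turns the remaining `c k(x)k(y)`
      -- into `-(s k(x))(s k(y))`.
      have hcos : SolvesCosine (fun x => -s ^ 2 * f x + b x) (fun x => s * k x) := by
        refine solvesCosine_of_bdd (indepModBdd_two (fun h => hf ?_) fun ⟨d, hd⟩ => hfk ?_) ?_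
        · exact Bdd.of_const_mul hc0 ((h.sub hb).of_eq fun x => by ring)
        · exact ⟨-d * s, ((hd.add (hb.const_mul d)).const_mul s⁻¹).of_eq fun x => by
            field_simp
            ring⟩
        · refine (((hD'.const_mul (-s ^ 2)).add hb.map_mul).sub (hb.fst.mul hb.snd)).of_eq
            fun p => ?_
          ring
      refine Or.inr (Or.inr (Or.inr (Or.inr (Or.inr (Or.inl ⟨β * s⁻¹, s⁻¹, b, _, _,
        inv_ne_zero hs0, hb, hcos, fun x => ?_, fun x => ?_, fun x => ?_⟩)))))
      · field_simp
        ring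
      · rw [hgx]
        field_simp
        ring
      · rw [hkdef]
        field_simp
        ring
  · show _ → Bdd _
    rintro (⟨rfl, hh⟩ | ⟨hf, hg, hh⟩ | ⟨c, a, m, b, φ, ha, hm, hmb, hb, hφ, hfx, hgx, hhx⟩ |
      ⟨α, c, m, b, φ, hm, hb, hφ, hfx, hgx, hhx⟩ | ⟨c, b, f₀, g₀, hb, hs, hfx, hgx, hhx⟩ |
      ⟨ρ, c, b, f₀, g₀, -, hb, hs, hfx, hgx, hhx⟩ |
      ⟨β, c, m, M, a, b, -, hm, hM, hmb, ha, hb, hfx, hgx, hhx⟩ |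
      ⟨β, m, a, a₁, b, hm, -, hmb, ha, ha₁, -, hb, hfx, hgx, hhx⟩ |
      ⟨β, a, m, b, ha, hm, hm0, hmb, hb, hgx, hhx, hE⟩ | hex)
    · have hh : Bdd h := hh
      exact (hh.fst.mul hh.snd).neg.of_eq fun p => by simp
    · have hf : Bdd f := hf
      have hg : Bdd g := hg
      have hh : Bdd h := hh
      exact ((hf.map_mul.sub (hf.fst.mul hg.snd)).sub (hg.fst.mul hf.snd)).sub
        (hh.fst.mul hh.snd)
    · have hmb : Bdd m := hmb
      have hb : Bdd b := hb
      have hφ : Bdd φ := hφ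
      refine (((hφ.map_mul.sub (hφ.fst.mul hmb.snd)).sub (hmb.fst.mul hφ.snd)).sub
        (hb.fst.mul hb.snd)).of_eq fun p => ?_
      simp only [hfx, hgx, hhx, ha p.1 p.2, hm p.1 p.2]
      ring
    · have hb : Bdd b := hb
      have hφ : Bdd φ := hφ
      refine (((hb.fst.mul hb.snd).sub hb.map_mul).const_mul α |>.sub
        (hφ.fst.mul hφ.snd)).of_eq fun p => ?_
      simp only [hfx, hgx, hhx, hm p.1 p.2]
      ring
    · have hb : Bdd b := hb
      refine (hb.fst.mul hb.snd).neg.of_eq fun p => ?_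
      simp only [hfx, hgx, hhx, hs p.1 p.2]
      ring
    · have hb : Bdd b := hb
      refine ((hb.map_mul.sub (hb.fst.mul hb.snd)).const_mul (c ^ 2)).of_eq fun p => ?_
      simp only [hfx, hgx, hhx, hs p.1 p.2]
      ring
    · have hmb : Bdd m := hmb
      have hb : Bdd b := hb
      refine (((hb.map_mul.sub (hb.fst.mul hmb.snd)).sub (hmb.fst.mul hb.snd)).sub
        ((hmb.fst.mul hmb.snd).const_mul (c ^ 2))).of_eq fun p => ?_
      simp only [hfx, hgx, hhx, ha p.1 p.2, hm p.1 p.2, hM p.1 p.2]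
      ring
    · have hmb : Bdd m := hmb
      have hb : Bdd b := hb
      refine ((hb.map_mul.sub (hb.fst.mul hmb.snd)).sub (hmb.fst.mul hb.snd)).of_eq fun p => ?_
      simp only [hfx, hgx, hhx, ha p.1 p.2, ha₁ p.1 p.2, hm p.1 p.2]
      ring
    · have hmb : Bdd m := hmb
      have hb : Bdd b := hb
      -- Multiplying the bounded expression of (9) by `m(x)m(y)` clears the inverses.
      refine (((Bdd.mul hE hmb.fst).mul hmb.snd).sub (hb.fst.mul hb.snd)).of_eq fun p => ?_
      have h₁ := hm.apply_ne_zero hm0 p.1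
      have h₂ := hm.apply_ne_zero hm0 p.2
      simp only [hgx, hhx, ha p.1 p.2, hm p.1 p.2, hm.apply_inv hm0]
      field_simp
      ring
    · exact (Bdd.const 0).of_eq fun p => by
        rw [hex]
        ring
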